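/- Let $H\ge 1$, and consider a fully connected feed-forward network (without biases) with $H$ hidden layers, input width $d_0$, hidden widths $d_1,\dots,d_H\ge 1$ and output width $d_{H+1}$. Let $X\in\mathbb{R}^{d_0\times N}$ be the matrix whose columns are the $N$ input samples, $Y\in\mathbb{R}^{d_{H+1}\times N}$ the matrix of targets, and $\sigma:\mathbb{R}\to\mathbb{R}$ the activation function. For weights $W=(W_1,\dots,W_{H+1})$, $W_i\in\mathbb{R}^{d_i\times d_{i-1}}$, put $$T_1=\sigma(W_1X),\qquad T_i=\sigma(W_iT_{i-1})\quad(2\le i\le H),\qquad E(W)=l(Y,W_{H+1}T_H),$$ where $\sigma$ is applied entrywise and $l$ is a real-valued loss function. Assume that - there is a coordinate $k$ with $X_{ki}\ne X_{kj}$ for all $i\ne j$; - $\hat Y\mapsto l(Y,\hat Y)$ is convex and continuous on $\mathbb{R}^{d_{H+1}\times N}$; - $d_H\ge N$; - $\sigma$ is continuous. Call a nonempty compact set $A$ of weights a *setwise strict local minimum* of $E$ if there is $\varepsilon>0$ such that $E(W)<E(W')$ for all $W\in A$ and all $W'\notin A$ with $\|W-W'\|_2\le\varepsilon$. Call a compact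 set $A$ a *setwise global minimum* of $E$ if $E$ attains its global minimum on $A$, i.e. some $W\in A$ satisfies $E(W)\le E(W')$ for all weights $W'$. Then $E$ is a weakly global function: $E$ is continuous, and every setwise strict local minimum of $E$ is a setwise global minimum of $E$. Moreover, every setwise strict local minimum $A$ of $E$ is also global in the sense that $E(W)\le E(W')$ for all $W\in A$ and all $W'\notin A$. -/

import Mathlib

/-- A nonempty compact set `A` is a strict local minimum of `f : S → ℝ` in the sense of sets:
for some `ε > 0`, every `x ∈ A` and every `y ∉ A` at distance at most `ε` from `x`
satisfy `f x < f y`. -/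
def IsSetwiseStrictLocalMin {S : Type*} [MetricSpace S] (f : S → ℝ) (A : Set S) : Prop :=
  A.Nonempty ∧ IsCompact A ∧
    ∃ ε : ℝ, 0 < ε ∧ ∀ x ∈ A, ∀ y ∉ A, dist x y ≤ ε → f x < f y

/-- A compact set `A` is a global minimum of `f : S → ℝ` in the sense of sets: the infimum of `f`
over `S` is attained on `A`. (For `f` continuous and `A` nonempty and compact, this says exactly
that the infima of `f` over `A` and over `S` agree.) -/
def IsSetwiseGlobalMin {S : Type*} [MetricSpace S] (f : S → ℝ) (A : Set S) : Prop :=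
  IsCompact A ∧ ∃ x ∈ A, ∀ y, f x ≤ f y

/-- A weakly global function: continuous, and every setwise strict local minimum is a setwise
global minimum. -/
def IsWeaklyGlobal {S : Type*} [MetricSpace S] (f : S → ℝ) : Prop :=
  Continuous f ∧ ∀ A : Set S, IsSetwiseStrictLocalMin f A → IsSetwiseGlobalMin f A

/-- The space of all weights `W = (W₁, …, W_{H+1})` of a network with layer widths
`d 0, d 1, …, d (H + 1)`, with the Euclidean norm. The coordinate `⟨i, (j, k)⟩` is the weight from
neuron `k` of layer `i` to neuron `j` of layer `i + 1`. -/
abbrev WeightSpace (H : ℕ) (d : ℕ → ℕ) : Type :=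
  EuclideanSpace ℝ (Σ i : Fin (H + 1), Fin (d (i.val + 1)) × Fin (d i.val))

/-- The weight matrix `W_{i+1}`, from layer `i` to layer `i + 1`. -/
def weightMatrix {H : ℕ} {d : ℕ → ℕ} (W : WeightSpace H d) (i : ℕ) (hi : i < H + 1) :
    Matrix (Fin (d (i + 1))) (Fin (d i)) ℝ :=
  Matrix.of fun j k => W ⟨⟨i, hi⟩, (j, k)⟩

/-- The outputs of the input and hidden layers on the data matrix `X` (samples are columns):
`T₀ = X` and `T_{i+1} = Φ(W_{i+1} T_i)` for `i < H`, with `Φ` the componentwise application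
of `σ`. -/
def layerOutput {H N : ℕ} {d : ℕ → ℕ} (σ : ℝ → ℝ) (X : Matrix (Fin (d 0)) (Fin N) ℝ)
    (W : WeightSpace H d) : (i : ℕ) → i ≤ H → Matrix (Fin (d i)) (Fin N) ℝ
  | 0, _ => X
  | i + 1, hi =>
    (weightMatrix W i (by omega) * layerOutput σ X W i (by omega)).map σ

/-- The output of the network on the data matrix `X`: `T_{H+1} = W_{H+1} T_H` (no activation in
the last layer). -/
def networkOutput {H N : ℕ} {d : ℕ → ℕ} (σ : ℝ → ℝ) (X : Matrix (Fin (d 0)) (Fin N) ℝ)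
    (W : WeightSpace H d) : Matrix (Fin (d (H + 1))) (Fin N) ℝ :=
  weightMatrix W H (by omega) * layerOutput σ X W H le_rfl

/-- The empirical loss `E(W) = l(Y, W_{H+1} T_H)`. -/
def empiricalLoss {H N : ℕ} {d : ℕ → ℕ} (σ : ℝ → ℝ)
    (l : Matrix (Fin (d (H + 1))) (Fin N) ℝ → Matrix (Fin (d (H + 1))) (Fin N) ℝ → ℝ)
    (X : Matrix (Fin (d 0)) (Fin N) ℝ) (Y : Matrix (Fin (d (H + 1))) (Fin N) ℝ)
    (W : WeightSpace H d) : ℝ :=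
  l Y (networkOutput σ X W)

open Polynomial

/-! The loss `E` has no setwise strict local minimum at all, so the claims about such minima hold
vacuously: every bounded open set around `W` has a frontier point with loss at most `E(W)`. By
`exists_frontier_le` this follows if `E` is quasiconvex in the last weight matrix and every value of
`E` is attained over each hidden-weight vector coming from a dense set, namely where the last hidden
layer has full column rank.

For a general `σ` this rank condition may fail everywhere, but it is generic for polynomials with
nonzero low coefficients (`exists_det_gram_ne_zero`, `dense_det_gram_ne_zero`). Such polynomials are
dense in `C(ℝ, ℝ)`, and failure of the frontier property is an open condition on `σ`, so the
property passes to every continuous `σ` (`exists_frontier_empiricalLoss_le`). -/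

/-! ### Topology of sublevel sets -/

theorem exists_frontier_le {S B : Type*} [NormedAddCommGroup S] [NormedSpace ℝ S] [ProperSpace S]
    [NormedAddCommGroup B] [NormedSpace ℝ B] [Nontrivial B] {π : S → B} (hπ : Continuous π)
    (hπo : IsOpenMap π) {f : S → ℝ} (hf : Continuous f)
    (hconv : ∀ w w', π w = π w' → ∀ z ∈ segment ℝ w w', f z ≤ max (f w) (f w'))
    {R : Set S} (hR : Dense R) (hlift : ∀ w ∈ R, ∀ w₀, ∃ w₁, π w₁ = π w ∧ f w₁ = f w₀)
    {U : Set S} (hUo : IsOpen U) (hUb : Bornology.IsBounded U) {w₀ : S} (hw₀ : w₀ ∈ U) :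
    ∃ y ∈ frontier U, f y ≤ f w₀ := by
  by_contra! h
  have hUc : IsCompact (closure U) := hUb.isCompact_closure
  have hFc : IsCompact (frontier U) := hUc.of_isClosed_subset isClosed_frontier
    frontier_subset_closure
  obtain ⟨c, hc, hcU⟩ := hFc.exists_forall_le' hf.continuousOn h
  -- The images of `K` and `V` under `π` will coincide: a nonempty, compact and open subset of the
  -- connected noncompact space `B`.
  set K : Set S := closure U ∩ {w | f w = f w₀}
  set V : Set S := U ∩ {w | f w < c}
  have hK : IsCompact K := hUc.inter_right (isClosed_eq hf continuous_const)
  have hV : IsOpen V := hUo.inter (isOpen_lt hf continuous_const)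
  have hKV : K ⊆ V := by
    rintro w ⟨hw, hfw⟩
    have hfw' : f w = f w₀ := hfw
    refine ⟨?_, show f w < c by rw [hfw']; exact hc⟩
    by_contra hwU
    have : w ∈ frontier U := by rw [hUo.frontier_eq]; exact ⟨hw, hwU⟩
    have := hcU w this
    linarith
  have hVR : V ∩ R ⊆ π ⁻¹' (π '' K) := by
    rintro w ⟨⟨hwU, hwc⟩, hwR⟩
    obtain ⟨w₁, hπw, hfw⟩ := hlift w hwR w₀
    refine ⟨w₁, ⟨subset_closure ?_, hfw⟩, hπw⟩
    by_contra hw₁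
    -- A segment from `U` to a point outside `U` crosses the frontier, where `f ≥ c`; on a segment
    -- inside a fibre of `π`, `f` stays below `c`.
    obtain ⟨z, hz, hzF⟩ : ∃ z ∈ segment ℝ w w₁, z ∈ frontier U := by
      by_contra! hF
      refine hw₁ ((convex_segment w w₁).isPreconnected.subset_left_of_subset_union hUo
        (isClosed_closure (s := U)).isOpen_compl
        (Set.disjoint_compl_right_iff_subset.2 subset_closure) (fun z hz => ?_)
        ⟨w, left_mem_segment ℝ w w₁, hwU⟩ (right_mem_segment ℝ w w₁))
      have hzF := hF z hz
      rw [hUo.frontier_eq] at hzF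
      by_cases hzU : z ∈ U
      · exact Or.inl hzU
      · exact Or.inr fun hzc => hzF ⟨hzc, hzU⟩
    have h1 := hconv w w₁ hπw.symm z hz
    have h2 := hcU z hzF
    have h3 : max (f w) (f w₁) < c := max_lt hwc (by rw [hfw]; exact hc)
    linarith
  have hVK : V ⊆ π ⁻¹' (π '' K) :=
    (hR.open_subset_closure_inter hV).trans
      (closure_minimal hVR ((hK.image hπ).isClosed.preimage hπ))
  have hEq : π '' K = π '' V :=
    (Set.image_mono hKV).antisymm (Set.image_subset_iff.2 hVK)
  have hclopen : IsClopen (π '' K) :=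
    ⟨(hK.image hπ).isClosed, hEq ▸ hπo V hV⟩
  have huniv := hclopen.eq_univ ⟨π w₀, w₀, ⟨subset_closure hw₀, rfl⟩, rfl⟩
  have : NoncompactSpace B := NormedSpace.noncompactSpace ℝ B
  exact noncompact_univ B (huniv ▸ hK.image hπ)

/-- Let `x` minimise `f` on `A`. A frontier point `y` of the `ε`-thickening with `f y ≤ f x` is
within `ε` of some `a ∈ A`, so `f a < f y ≤ f x ≤ f a`. -/
theorem not_isSetwiseStrictLocalMin {S : Type*} [MetricSpace S] {f : S → ℝ} (hf : Continuous f)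
    (hmin : ∀ U : Set S, IsOpen U → Bornology.IsBounded U → ∀ w ∈ U, ∃ y ∈ frontier U, f y ≤ f w)
    (A : Set S) : ¬ IsSetwiseStrictLocalMin f A := by
  rintro ⟨hne, hA, ε, hε, h⟩
  obtain ⟨x, hx, hxmin⟩ := hA.exists_isMinOn hne hf.continuousOn
  obtain ⟨y, hy, hyx⟩ := hmin (Metric.thickening ε A) Metric.isOpen_thickening
    hA.isBounded.thickening x (Metric.self_subset_thickening hε A hx)
  rw [Metric.isOpen_thickening.frontier_eq] at hy
  have hyA : y ∉ A := fun hyA => hy.2 (Metric.self_subset_thickening hε A hyA)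
  obtain ⟨a, ha, hay⟩ := hA.exists_infDist_eq_dist hne y
  have h1 : Metric.infDist y A ≤ ε :=
    ENNReal.toReal_le_of_le_ofReal hε.le <| Metric.mem_cthickening_iff.1
      (Metric.closure_thickening_subset_cthickening ε A hy.1)
  have h2 := h a ha y hyA (by rw [dist_comm, ← hay]; exact h1)
  have h3 : f x ≤ f a := hxmin ha
  linarith

/-! ### Hidden weights versus the last weight matrix -/

/-- Replace the last weight matrix of `W` by `V`. -/
noncomputable def replaceLast {H : ℕ} {d : ℕ → ℕ} (W : WeightSpace H d)
    (V : Matrix (Fin (d (H + 1))) (Fin (d H)) ℝ) : WeightSpace H d :=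
  WithLp.toLp 2 fun s => Fin.lastCases
    (motive := fun i : Fin (H + 1) => Fin (d (i.val + 1)) × Fin (d i.val) → ℝ)
    (fun p => V p.1 p.2) (fun i p => W ⟨i.castSucc, p⟩) s.1 s.2

/-- The weights of the hidden layers. -/
def hiddenWeights {H : ℕ} {d : ℕ → ℕ} (W : WeightSpace H d) :
    (Σ i : Fin H, Fin (d (i.val + 1)) × Fin (d i.val)) → ℝ :=
  fun s => W ⟨s.1.castSucc, s.2⟩

theorem weightMatrix_replaceLast {H : ℕ} {d : ℕ → ℕ} (W : WeightSpace H d)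
    (V : Matrix (Fin (d (H + 1))) (Fin (d H)) ℝ) :
    weightMatrix (replaceLast W V) H (by omega) = V := by
  ext j k
  exact congrFun (Fin.lastCases_last
    (motive := fun i : Fin (H + 1) => Fin (d (i.val + 1)) × Fin (d i.val) → ℝ)) (j, k)

theorem hiddenWeights_replaceLast {H : ℕ} {d : ℕ → ℕ} (W : WeightSpace H d)
    (V : Matrix (Fin (d (H + 1))) (Fin (d H)) ℝ) :
    hiddenWeights (replaceLast W V) = hiddenWeights W := by
  funext s
  exact congrFun (Fin.lastCases_castSucc
    (motive := fun i : Fin (H + 1) => Fin (d (i.val + 1)) × Fin (d i.val) → ℝ) s.1) s.2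

theorem weightMatrix_congr {H : ℕ} {d : ℕ → ℕ} {W W' : WeightSpace H d}
    (h : hiddenWeights W = hiddenWeights W') (i : ℕ) (hi : i < H) :
    weightMatrix W i (by omega) = weightMatrix W' i (by omega) := by
  ext j k
  exact congrFun h ⟨⟨i, hi⟩, (j, k)⟩

theorem layerOutput_congr {H N : ℕ} {d : ℕ → ℕ} (σ : ℝ → ℝ) (X : Matrix (Fin (d 0)) (Fin N) ℝ)
    {W W' : WeightSpace H d} (h : hiddenWeights W = hiddenWeights W') (i : ℕ) (hi : i ≤ H) :
    layerOutput σ X W i hi = layerOutput σ X W' i hi := by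
  induction i with
  | zero => rfl
  | succ i ih => simp only [layerOutput, ih (by omega), weightMatrix_congr h i hi]

theorem continuous_hiddenWeights {H : ℕ} {d : ℕ → ℕ} :
    Continuous (hiddenWeights : WeightSpace H d → _) := by
  unfold hiddenWeights; fun_prop

theorem isOpenMap_hiddenWeights {H : ℕ} {d : ℕ → ℕ} :
    IsOpenMap (hiddenWeights : WeightSpace H d → _) := by
  let L : WeightSpace H d →ₗ[ℝ] (Σ i : Fin H, Fin (d (i.val + 1)) × Fin (d i.val)) → ℝ :=
    { toFun := hiddenWeights, map_add' := fun _ _ => rfl, map_smul' := fun _ _ => rfl }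
  refine L.isOpenMap_of_finiteDimensional fun b => ?_
  refine ⟨WithLp.toLp 2 fun s => Fin.lastCases
    (motive := fun i : Fin (H + 1) => Fin (d (i.val + 1)) × Fin (d i.val) → ℝ)
    (fun _ => 0) (fun i p => b ⟨i, p⟩) s.1 s.2, ?_⟩
  funext s
  exact congrFun (Fin.lastCases_castSucc
    (motive := fun i : Fin (H + 1) => Fin (d (i.val + 1)) × Fin (d i.val) → ℝ) s.1) s.2

/-- Continuity is joint in activation and weights, so that the activation can later be perturbed
uniformly over a compact set of weights. -/
theorem continuous_layerOutput {H N : ℕ} {d : ℕ → ℕ} (X : Matrix (Fin (d 0)) (Fin N) ℝ) (i : ℕ)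
    (hi : i ≤ H) :
    Continuous fun q : C(ℝ, ℝ) × WeightSpace H d => layerOutput q.1 X q.2 i hi := by
  induction i with
  | zero => exact continuous_const
  | succ i ih =>
    have h1 : Continuous fun q : C(ℝ, ℝ) × WeightSpace H d =>
        weightMatrix q.2 i (by omega) * layerOutput q.1 X q.2 i (by omega) :=
      Continuous.matrix_mul (continuous_matrix fun j k => by
        simp only [weightMatrix, Matrix.of_apply]; fun_prop) (ih (by omega))
    refine continuous_matrix fun j k => ?_
    exact continuous_fst.eval (h1.matrix_elem j k)

theorem continuous_empiricalLoss {H N : ℕ} {d : ℕ → ℕ} (X : Matrix (Fin (d 0)) (Fin N) ℝ)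
    {l : Matrix (Fin (d (H + 1))) (Fin N) ℝ → Matrix (Fin (d (H + 1))) (Fin N) ℝ → ℝ}
    {Y : Matrix (Fin (d (H + 1))) (Fin N) ℝ} (hl : Continuous (l Y)) :
    Continuous fun q : C(ℝ, ℝ) × WeightSpace H d => empiricalLoss q.1 l X Y q.2 :=
  hl.comp (Continuous.matrix_mul (continuous_matrix fun j k => by
    simp only [weightMatrix, Matrix.of_apply]; fun_prop) (continuous_layerOutput X H le_rfl))

theorem empiricalLoss_le_max_of_mem_segment {H N : ℕ} {d : ℕ → ℕ} (σ : ℝ → ℝ)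
    (X : Matrix (Fin (d 0)) (Fin N) ℝ)
    {l : Matrix (Fin (d (H + 1))) (Fin N) ℝ → Matrix (Fin (d (H + 1))) (Fin N) ℝ → ℝ}
    {Y : Matrix (Fin (d (H + 1))) (Fin N) ℝ} (hl : ConvexOn ℝ Set.univ (l Y))
    {W W' Z : WeightSpace H d} (h : hiddenWeights W = hiddenWeights W')
    (hZ : Z ∈ segment ℝ W W') :
    empiricalLoss σ l X Y Z ≤ max (empiricalLoss σ l X Y W) (empiricalLoss σ l X Y W') := by
  obtain ⟨a, b, ha, hb, hab, rfl⟩ := hZ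
  have hh : hiddenWeights (a • W + b • W') = hiddenWeights W := by
    have : hiddenWeights (a • W + b • W') = a • hiddenWeights W + b • hiddenWeights W' := rfl
    rw [this, ← h, ← add_smul, hab, one_smul]
  have hw : weightMatrix (a • W + b • W') H (by omega) =
      a • weightMatrix W H (by omega) + b • weightMatrix W' H (by omega) := rfl
  have hout : networkOutput σ X (a • W + b • W') =
      a • networkOutput σ X W + b • networkOutput σ X W' := by
    simp only [networkOutput]
    rw [layerOutput_congr σ X hh, ← layerOutput_congr σ X h, hw, Matrix.add_mul,
      Matrix.smul_mul, Matrix.smul_mul]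
  unfold empiricalLoss
  rw [hout]
  exact hl.le_max_of_mem_segment (Set.mem_univ _) (Set.mem_univ _) ⟨a, b, ha, hb, hab, rfl⟩

/-- When `TᵀT` is invertible, `(TᵀT)⁻¹Tᵀ` is a left inverse of `T`, so the last matrix alone can
produce any prescribed output. -/
theorem exists_empiricalLoss_eq {H N : ℕ} {d : ℕ → ℕ} (σ : ℝ → ℝ)
    (X : Matrix (Fin (d 0)) (Fin N) ℝ)
    (l : Matrix (Fin (d (H + 1))) (Fin N) ℝ → Matrix (Fin (d (H + 1))) (Fin N) ℝ → ℝ)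
    (Y : Matrix (Fin (d (H + 1))) (Fin N) ℝ) {W : WeightSpace H d}
    (hW : ((layerOutput σ X W H le_rfl).transpose * layerOutput σ X W H le_rfl).det ≠ 0)
    (W₀ : WeightSpace H d) :
    ∃ W₁, hiddenWeights W₁ = hiddenWeights W ∧
      empiricalLoss σ l X Y W₁ = empiricalLoss σ l X Y W₀ := by
  set T := layerOutput σ X W H le_rfl with hT
  refine ⟨replaceLast W (networkOutput σ X W₀ * ((T.transpose * T)⁻¹ * T.transpose)),
    hiddenWeights_replaceLast _ _, ?_⟩
  have : networkOutput σ X (replaceLast W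
      (networkOutput σ X W₀ * ((T.transpose * T)⁻¹ * T.transpose))) = networkOutput σ X W₀ := by
    conv_lhs => rw [networkOutput]
    rw [weightMatrix_replaceLast, layerOutput_congr σ X (hiddenWeights_replaceLast _ _), ← hT,
      Matrix.mul_assoc, Matrix.mul_assoc, Matrix.nonsing_inv_mul _ (isUnit_iff_ne_zero.2 hW),
      Matrix.mul_one]
  rw [empiricalLoss, this, empiricalLoss]

/-! ### Generic full rank for polynomial activations -/

theorem analyticAt_layerOutput_eval {H N : ℕ} {d : ℕ → ℕ} (p : ℝ[X])
    (X : Matrix (Fin (d 0)) (Fin N) ℝ) (i : ℕ) (hi : i ≤ H) (j : Fin (d i)) (k : Fin N)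
    (W₀ : WeightSpace H d) :
    AnalyticAt ℝ (fun W : WeightSpace H d => layerOutput (fun x => p.eval x) X W i hi j k) W₀ := by
  induction i with
  | zero => exact analyticAt_const
  | succ i ih =>
    have h0 (s) : AnalyticAt ℝ (fun W : WeightSpace H d => W s) W₀ :=
      (EuclideanSpace.proj (𝕜 := ℝ) s).analyticAt W₀
    have h1 : AnalyticAt ℝ (fun W : WeightSpace H d => ∑ m, weightMatrix W i (by omega) j m *
        layerOutput (fun x => p.eval x) X W i (by omega) m k) W₀ :=
      Finset.analyticAt_fun_sum _ fun m _ =>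
        (h0 ⟨⟨i, by omega⟩, (j, m)⟩).mul (ih (by omega) m)
    have h2 := h1.aeval_polynomial p
    simp only [Polynomial.coe_aeval_eq_eval] at h2
    exact h2

/-- The determinant is analytic in the weights; vanishing on an open set would force it to vanish
identically. -/
theorem dense_det_gram_ne_zero {H N : ℕ} {d : ℕ → ℕ} (p : ℝ[X])
    (X : Matrix (Fin (d 0)) (Fin N) ℝ)
    (h : ∃ W : WeightSpace H d, ((layerOutput (fun x => p.eval x) X W H le_rfl).transpose *
      layerOutput (fun x => p.eval x) X W H le_rfl).det ≠ 0) :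
    Dense {W : WeightSpace H d | ((layerOutput (fun x => p.eval x) X W H le_rfl).transpose *
      layerOutput (fun x => p.eval x) X W H le_rfl).det ≠ 0} := by
  set g : WeightSpace H d → ℝ := fun W =>
    ((layerOutput (fun x => p.eval x) X W H le_rfl).transpose *
      layerOutput (fun x => p.eval x) X W H le_rfl).det with hg
  have hga : AnalyticOnNhd ℝ g Set.univ := by
    intro W _
    simp only [hg, Matrix.det_apply', Matrix.mul_apply, Matrix.transpose_apply]
    refine Finset.analyticAt_fun_sum _ fun τ _ => analyticAt_const.mul ?_
    refine Finset.analyticAt_fun_prod _ fun i _ => ?_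
    exact Finset.analyticAt_fun_sum _ fun m _ =>
      (analyticAt_layerOutput_eval p X H le_rfl m _ W).mul
        (analyticAt_layerOutput_eval p X H le_rfl m _ W)
  obtain ⟨W₁, hW₁⟩ := h
  intro W
  by_contra hW
  have hev : g =ᶠ[nhds W] 0 := by
    have : ∀ᶠ W' in nhds W, W' ∉ {W | g W ≠ 0} := by
      simpa [mem_closure_iff_frequently] using hW
    filter_upwards [this] with W' hW' using not_not.1 hW'
  exact hW₁ (hga.eqOn_zero_of_preconnected_of_eventuallyEq_zero isPreconnected_univ
    (Set.mem_univ W) hev (Set.mem_univ W₁))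

/-- Each difference `p(a tᵢ) - p(a tⱼ)` is a nonzero polynomial in `a`, by its linear coefficient;
take a non-root of their product. -/
theorem exists_injective_eval_mul {N : ℕ} {p : ℝ[X]} (hp : p.coeff 1 ≠ 0) {t : Fin N → ℝ}
    (ht : Function.Injective t) :
    ∃ a : ℝ, Function.Injective fun j => p.eval (a * t j) := by
  let q : Fin N × Fin N → ℝ[X] := fun ij => p.comp (C (t ij.1) * X) - p.comp (C (t ij.2) * X)
  have hq : ∀ ij : Fin N × Fin N, ij.1 ≠ ij.2 → q ij ≠ 0 := by
    intro ij hij h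
    have h1 : (q ij).coeff 1 = 0 := by rw [h, coeff_zero]
    simp only [q, coeff_sub, comp_C_mul_X_coeff, pow_one, ← mul_sub] at h1
    exact (mul_ne_zero hp (sub_ne_zero.2 (ht.ne hij))) h1
  have hprod : ∏ ij ∈ Finset.univ.filter (fun ij : Fin N × Fin N => ij.1 ≠ ij.2), q ij ≠ 0 :=
    Finset.prod_ne_zero_iff.2 fun ij hij => hq ij (Finset.mem_filter.1 hij).2
  obtain ⟨a, ha⟩ : ∃ a, (∏ ij ∈ Finset.univ.filter
      (fun ij : Fin N × Fin N => ij.1 ≠ ij.2), q ij).eval a ≠ 0 := by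
    by_contra! h
    exact hprod (Polynomial.funext fun a => by rw [h a, eval_zero])
  refine ⟨a, fun i j hij => ?_⟩
  by_contra hne
  rw [eval_prod] at ha
  refine Finset.prod_ne_zero_iff.1 ha (i, j) (Finset.mem_filter.2 ⟨Finset.mem_univ _, hne⟩) ?_
  have hij' : p.eval (a * t i) = p.eval (a * t j) := hij
  simp [q, eval_comp, mul_comm _ a, hij']

/-- A `v` orthogonal to `(p(a tⱼ))ⱼ` for all `a` satisfies `∑ tⱼᵏ vⱼ = 0` for `k < N`, comparing
coefficients in `a`; Vandermonde gives `v = 0`. At most `N` values of `a` already span all these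
vectors. -/
theorem exists_eval_mul_separating {N m : ℕ} (hNm : N ≤ m) {p : ℝ[X]}
    (hp : ∀ k < N, p.coeff k ≠ 0) {t : Fin N → ℝ} (ht : Function.Injective t) :
    ∃ w : ℕ → ℝ, ∀ v : Fin N → ℝ, (∀ r < m, ∑ j, p.eval (w r * t j) * v j = 0) → v = 0 := by
  let S : Set (Fin N → ℝ) := Set.range fun (a : ℝ) (j : Fin N) => p.eval (a * t j)
  obtain ⟨f, hf, hspan, -⟩ := Submodule.exists_fun_fin_finrank_span_eq ℝ S
  choose a ha using hf
  have hnN : Module.finrank ℝ (Submodule.span ℝ S) ≤ N := by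
    simpa using Submodule.finrank_le (Submodule.span ℝ S)
  refine ⟨fun r => if h : r < Module.finrank ℝ (Submodule.span ℝ S) then a ⟨r, h⟩ else 0,
    fun v hv => ?_⟩
  let φ : (Fin N → ℝ) →ₗ[ℝ] ℝ := ∑ j, v j • LinearMap.proj j
  have hφ (x : Fin N → ℝ) : φ x = ∑ j, x j * v j := by simp [φ, mul_comm]
  have hker : Submodule.span ℝ S ≤ LinearMap.ker φ := by
    rw [← hspan, Submodule.span_le]
    rintro _ ⟨i, rfl⟩
    have h1 := hv i (by omega)
    simp only [i.isLt, dif_pos, Fin.eta] at h1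
    change φ (f i) = 0
    rw [hφ, ← ha i]
    exact h1
  have hzero (b : ℝ) : ∑ j, p.eval (b * t j) * v j = 0 := by
    rw [← hφ]
    exact hker (Submodule.subset_span ⟨b, rfl⟩)
  have hpoly : ∑ j, p.comp (C (t j) * X) * C (v j) = 0 := by
    refine Polynomial.funext fun b => ?_
    simpa [eval_finsetSum, eval_comp, mul_comm _ b] using hzero b
  refine Matrix.eq_zero_of_forall_pow_sum_mul_pow_eq_zero ht fun k => ?_
  have hk : (∑ j, p.comp (C (t j) * X) * C (v j)).coeff k = 0 := by rw [hpoly, coeff_zero]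
  simp only [finsetSum_coeff, coeff_mul_C, comp_C_mul_X_coeff, mul_assoc,
    ← Finset.mul_sum] at hk
  simpa [mul_comm] using (mul_eq_zero.1 hk).resolve_left (hp k k.2)

theorem exists_det_gram_ne_zero {H N : ℕ} (hH : 1 ≤ H) {d : ℕ → ℕ}
    (hd : ∀ i, 1 ≤ i → i ≤ H → 1 ≤ d i) {X : Matrix (Fin (d 0)) (Fin N) ℝ} {k : Fin (d 0)}
    (hX : Function.Injective (X k)) (hwidth : N ≤ d H) {p : ℝ[X]}
    (hp : ∀ k ≤ N, p.coeff k ≠ 0) :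
    ∃ W : WeightSpace H d, ((layerOutput (fun x => p.eval x) X W H le_rfl).transpose *
      layerOutput (fun x => p.eval x) X W H le_rfl).det ≠ 0 := by
  obtain ⟨n, rfl⟩ : ∃ n, H = n + 1 := ⟨H - 1, by omega⟩
  have hstep (t : {t : Fin N → ℝ // Function.Injective t}) :
      ∃ a : ℝ, Function.Injective fun j => p.eval (a * t.1 j) := by
    rcases Nat.eq_zero_or_pos N with rfl | hN
    · exact ⟨0, Function.injective_of_subsingleton _⟩
    · exact exists_injective_eval_mul (hp 1 hN) t.2
  choose g hg using hstep
  let t : ℕ → {t : Fin N → ℝ // Function.Injective t} :=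
    fun i => Nat.rec ⟨X k, hX⟩ (fun _ s => ⟨_, hg s⟩) i
  obtain ⟨w, hw⟩ := exists_eval_mul_separating hwidth (fun k hk => hp k hk.le) (t n).2
  -- In the witness network every neuron reads only neuron `r i` of layer `i`. These neurons carry
  -- injective data up to layer `n`; the last hidden layer then uses the separating weights `w`.
  let r : ℕ → ℕ := fun i => if i = 0 then k else 0
  have hr (i : ℕ) (hi : i ≤ n + 1) : r i < d i := by
    rcases Nat.eq_zero_or_pos i with rfl | hi'
    · simp [r]
    · simpa [r, hi'.ne'] using Nat.lt_of_lt_of_le one_pos (hd i hi' hi)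
  let a : ℕ → ℕ → ℝ := fun i j => if i = n then w j else g (t i)
  let W : WeightSpace (n + 1) d :=
    WithLp.toLp 2 fun s => if s.2.2.val = r s.1.val then a s.1 s.2.1 else 0
  have hlayer (i : ℕ) (hi : i + 1 ≤ n + 1) (j : Fin (d (i + 1))) (s : Fin N) :
      layerOutput (fun x => p.eval x) X W (i + 1) hi j s = p.eval
        (a i j * layerOutput (fun x => p.eval x) X W i (by omega) ⟨r i, hr i (by omega)⟩ s) := by
    change p.eval (∑ m : Fin (d i), (if m.val = r i then a i j else 0) *
      layerOutput (fun x => p.eval x) X W i (by omega) m s) = _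
    rw [Finset.sum_eq_single (⟨r i, hr i (by omega)⟩ : Fin (d i))]
    · simp
    · intro m _ hm
      rw [if_neg fun h => hm (Fin.ext h), zero_mul]
    · simp
  have ht (i : ℕ) (hi : i ≤ n) (s : Fin N) :
      layerOutput (fun x => p.eval x) X W i (by omega) ⟨r i, hr i (by omega)⟩ s = (t i).1 s := by
    induction i with
    | zero => rfl
    | succ i ih =>
      rw [hlayer, ih (by omega)]
      simp only [a, if_neg (show i ≠ n by omega)]
      rfl
  refine ⟨W, fun hdet => ?_⟩
  obtain ⟨v, hv, hv0⟩ := Matrix.exists_mulVec_eq_zero_iff.2 hdet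
  set T := layerOutput (fun x => p.eval x) X W (n + 1) le_rfl
  have hTv : v ∈ LinearMap.ker (T.transpose * T).mulVecLin := hv0
  rw [Matrix.ker_mulVecLin_transpose_mul_self] at hTv
  refine hv (hw v fun q hq => ?_)
  have h1 : T.mulVec v ⟨q, hq⟩ = 0 := congrFun hTv _
  rw [← h1]
  refine Finset.sum_congr rfl fun s _ => ?_
  simp only [T, hlayer, ht n le_rfl, a, if_true]

/-! ### Approximation of the activation -/

theorem dense_toContinuousMap_coeff_ne_zero (N : ℕ) :
    Dense {σ : C(ℝ, ℝ) | ∃ p : ℝ[X], (∀ k ≤ N, p.coeff k ≠ 0) ∧ p.toContinuousMap = σ} := by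
  set G : Set C(ℝ, ℝ) := {σ | ∃ p : ℝ[X], (∀ k ≤ N, p.coeff k ≠ 0) ∧ p.toContinuousMap = σ}
  have hpoly (p : ℝ[X]) : p.toContinuousMap ∈ closure G := by
    -- Adding `η q` shifts every coefficient up to degree `N` by `η`, so only finitely many `η` are
    -- bad.
    let q : ℝ[X] := ∑ k ∈ Finset.range (N + 1), X ^ k
    have hq (k : ℕ) (hk : k ≤ N) : q.coeff k = 1 := by
      simp [q, coeff_X_pow, hk]
    have hfin : Set.Finite ((fun k => -p.coeff k) '' Set.Iic N) := (Set.finite_Iic N).image _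
    have hdense : Dense ((fun k => -p.coeff k) '' Set.Iic N)ᶜ :=
      hfin.countable.dense_compl ℝ
    let F : ℝ → C(ℝ, ℝ) := fun η => p.toContinuousMap + η • q.toContinuousMap
    have hF : Continuous F := by fun_prop
    have h0 : F 0 = p.toContinuousMap := by simp [F]
    rw [← h0]
    refine map_mem_closure hF (hdense 0) fun η hη => ⟨p + C η * q, fun k hk h => hη ?_, ?_⟩
    · rw [coeff_add, coeff_C_mul, hq k hk] at h
      exact ⟨k, hk, by simp only; linarith⟩
    · ext x
      simp [F]
  intro σ
  have happrox (n : ℕ) : ∃ p : ℝ[X], ∀ x ∈ Set.Icc (-(n : ℝ)) n,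
      |p.eval x - σ x| < 1 / ((n : ℝ) + 1) :=
    exists_polynomial_near_of_continuousOn _ _ σ σ.continuous.continuousOn _
      Nat.one_div_pos_of_nat
  choose p hp using happrox
  rw [← closure_closure]
  refine mem_closure_of_tendsto (f := fun n => (p n).toContinuousMap) (b := Filter.atTop) ?_
    (Filter.Eventually.of_forall fun n => hpoly _)
  rw [ContinuousMap.tendsto_iff_forall_isCompact_tendstoUniformlyOn]
  intro K hK
  rw [Metric.tendstoUniformlyOn_iff]
  intro ε hε
  obtain ⟨M, hM⟩ := hK.isBounded.exists_norm_le
  obtain ⟨n₀, hn₀⟩ := exists_nat_ge M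
  filter_upwards [Filter.eventually_ge_atTop n₀,
    (tendsto_one_div_add_atTop_nhds_zero_nat (𝕜 := ℝ)).eventually (gt_mem_nhds hε)]
    with n hn hnε x hx
  have h1 : |x| ≤ n := (hM x hx).trans (hn₀.trans (Nat.cast_le.2 hn))
  rw [dist_comm, Real.dist_eq]
  exact (hp n x (abs_le.1 h1)).trans hnε

theorem exists_frontier_empiricalLoss_le {H N : ℕ} (hH : 1 ≤ H) {d : ℕ → ℕ}
    (hd : ∀ i, 1 ≤ i → i ≤ H → 1 ≤ d i)
    {X : Matrix (Fin (d 0)) (Fin N) ℝ} {Y : Matrix (Fin (d (H + 1))) (Fin N) ℝ} {k : Fin (d 0)}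
    (hX : Function.Injective (X k))
    {l : Matrix (Fin (d (H + 1))) (Fin N) ℝ → Matrix (Fin (d (H + 1))) (Fin N) ℝ → ℝ}
    (hl_convex : ConvexOn ℝ Set.univ (l Y)) (hl_cont : Continuous (l Y)) (hwidth : N ≤ d H)
    (σ : C(ℝ, ℝ)) {U : Set (WeightSpace H d)} (hUo : IsOpen U) (hUb : Bornology.IsBounded U)
    {W : WeightSpace H d} (hW : W ∈ U) :
    ∃ Z ∈ frontier U, empiricalLoss σ l X Y Z ≤ empiricalLoss σ l X Y W := by
  by_contra! h
  have hE := continuous_empiricalLoss (d := d) X hl_cont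
  have hFc : IsCompact (frontier U) := hUb.isCompact_closure.of_isClosed_subset
    isClosed_frontier frontier_subset_closure
  -- Compactness of the frontier makes the strict inequality stable under small changes of the
  -- activation.
  have hev : ∀ᶠ τ : C(ℝ, ℝ) in nhds σ, ∀ Z ∈ frontier U,
      empiricalLoss τ l X Y W < empiricalLoss τ l X Y Z := by
    refine hFc.eventually_forall_of_forall_eventually fun Z hZ => ?_
    exact (isOpen_lt (hE.comp (continuous_fst.prodMk continuous_const)) hE).mem_nhds (h Z hZ)
  obtain ⟨_, hlt, p, hp, rfl⟩ :=
    mem_closure_iff_nhds.1 (dense_toContinuousMap_coeff_ne_zero N σ) _ hev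
  -- At least one hidden weight exists, so the base space is nontrivial and hence noncompact.
  have : Nonempty (Σ i : Fin H, Fin (d (i.val + 1)) × Fin (d i.val)) :=
    ⟨⟨⟨0, hH⟩, (⟨0, hd 1 le_rfl hH⟩, k)⟩⟩
  obtain ⟨Z, hZ, hZW⟩ := exists_frontier_le continuous_hiddenWeights isOpenMap_hiddenWeights
    (hE.comp (Continuous.prodMk_right p.toContinuousMap))
    (fun _ _ hw _ hz => empiricalLoss_le_max_of_mem_segment _ X hl_convex hw hz)
    (dense_det_gram_ne_zero p X (exists_det_gram_ne_zero hH hd hX hwidth hp))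
    (fun _ hw => exists_empiricalLoss_eq _ X l Y hw) hUo hUb hW
  exact (hlt Z hZ).not_ge hZW

theorem theorem1 (H N : ℕ) (hH : 1 ≤ H) (d : ℕ → ℕ)
    (hd : ∀ i, 1 ≤ i → i ≤ H → 1 ≤ d i)
    (X : Matrix (Fin (d 0)) (Fin N) ℝ) (Y : Matrix (Fin (d (H + 1))) (Fin N) ℝ)
    (hX : ∃ k : Fin (d 0), ∀ i j : Fin N, i ≠ j → X k i ≠ X k j)
    (l : Matrix (Fin (d (H + 1))) (Fin N) ℝ → Matrix (Fin (d (H + 1))) (Fin N) ℝ → ℝ)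
    (hl_convex : ConvexOn ℝ Set.univ (l Y)) (hl_cont : Continuous (l Y))
    (hwidth : N ≤ d H)
    (σ : ℝ → ℝ) (hσ : Continuous σ) :
    IsWeaklyGlobal (fun W : WeightSpace H d => empiricalLoss σ l X Y W) ∧
      ∀ A : Set (WeightSpace H d),
        IsSetwiseStrictLocalMin (fun W : WeightSpace H d => empiricalLoss σ l X Y W) A →
          ∀ W ∈ A, ∀ W' ∉ A, empiricalLoss σ l X Y W ≤ empiricalLoss σ l X Y W' := by
  obtain ⟨k, hk⟩ := hX
  have hXk : Function.Injective (X k) := fun i j hij => by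
    by_contra hne
    exact hk i j hne hij
  have hcont : Continuous fun W : WeightSpace H d => empiricalLoss σ l X Y W :=
    (continuous_empiricalLoss X hl_cont).comp (Continuous.prodMk_right (⟨σ, hσ⟩ : C(ℝ, ℝ)))
  have hnone := not_isSetwiseStrictLocalMin hcont fun _ hUo hUb _ hW =>
    exists_frontier_empiricalLoss_le hH hd hXk hl_convex hl_cont hwidth ⟨σ, hσ⟩ hUo hUb hW
  exact ⟨⟨hcont, fun A hA => (hnone A hA).elim⟩, fun A hA => (hnone A hA).elim⟩
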